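/- Let $k\ge 2$ be an integer and let $\varepsilon>0$. Write $[n_1,\ldots,n_k]$ for the least common multiple of the positive integers $n_1,\ldots,n_k$, $\mu$ for the Möbius function, $\zeta$ for the Riemann zeta function, $\mathbb{N}=\{1,2,\ldots\}$, and $V_k=\pi^{k/2}/\Gamma(k/2+1)$ for the volume of the $k$-dimensional unit ball. Then for all real $x\ge 1$, $$\sum_{\substack{n_1,\ldots,n_k\in\mathbb{N}\\ n_1^2+\cdots+n_k^2\le x}}\mu^2([n_1,\ldots,n_k]) = \frac{V_k}{(2\zeta(2))^k}\,x^{k/2} + O\left(x^{k/2-1/4+\varepsilon}\right),$$ where the implied constant depends only on $k$ and $\varepsilon$. -/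

import Mathlib

/-- The constant `V_k = π^(k/2) / Γ(k/2 + 1)`, the volume of the unit ball of `ℝ^k`. -/
noncomputable def unitBallVolume (k : ℕ) : ℝ :=
  Real.pi ^ ((k : ℝ) / 2) / Real.Gamma ((k : ℝ) / 2 + 1)

open Classical in
/-- The finite set of `k`-tuples of positive integers with `n_1^2 + ⋯ + n_k^2 ≤ x`.
The bounding box only serves to make the set visibly finite,
see `mem_positiveBallPoints`. -/
noncomputable def positiveBallPoints (k : ℕ) (x : ℝ) : Finset (Fin k → ℕ) :=
  (Fintype.piFinset fun _ : Fin k => Finset.Icc 1 ⌊Real.sqrt x⌋₊).filter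
    fun n => ∑ i, (n i : ℝ) ^ 2 ≤ x

theorem mem_positiveBallPoints {k : ℕ} {x : ℝ} {n : Fin k → ℕ} :
    n ∈ positiveBallPoints k x ↔ (∀ i, 1 ≤ n i) ∧ ∑ i, (n i : ℝ) ^ 2 ≤ x := by
  simp only [positiveBallPoints, Finset.mem_filter, Fintype.mem_piFinset, Finset.mem_Icc]
  constructor
  · rintro ⟨h, hx⟩
    exact ⟨fun i => (h i).1, hx⟩
  · rintro ⟨h, hx⟩
    refine ⟨fun i => ⟨h i, Nat.le_floor (Real.le_sqrt_of_sq_le ?_)⟩, hx⟩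
    exact (Finset.single_le_sum (f := fun i => (n i : ℝ) ^ 2) (fun j _ => sq_nonneg _)
      (Finset.mem_univ i)).trans hx

/-- The value `ζ(2)` as a real number. -/
noncomputable def zetaTwo : ℝ := (riemannZeta 2).re

theorem ofReal_zetaTwo : (zetaTwo : ℂ) = riemannZeta 2 := by
  have h : riemannZeta 2 = ((Real.pi ^ 2 / 6 : ℝ) : ℂ) := by
    rw [riemannZeta_two]; push_cast; rfl
  rw [zetaTwo, h, Complex.ofReal_re]

/-! An lcm is squarefree exactly when every entry is, so the sum counts points with squarefree
coordinates (`squarefreeBallCount`). Slicing by the first coordinate, `squarefreeBallCount_succ`,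
allows induction on `k`. Put the main term for dimension `k` into each slice. Squarefree numbers
have density `1/ζ(2)` with error `O(√n)`, so partial summation against the decreasing weight `(x -
t²)^(k/2)` turns the sum over slices into an integral with error `O(x^(k/2 + 1/4))`. That integral
is the one in the recursion `unitBallVolume_succ`. The inductive errors, at most `√x` slices of
`O(x^(k/2 - 1/4))` each, have the same size. The induction gives the bound without `ε`. -/

theorem Nat.squarefree_finset_lcm_iff {ι : Type*} (s : Finset ι) (n : ι → ℕ) :
    Squarefree (s.lcm n) ↔ ∀ i ∈ s, Squarefree (n i) := by
  classical
  refine ⟨fun h i hi => h.squarefree_of_dvd (Finset.dvd_lcm hi), fun h => ?_⟩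
  induction s using Finset.induction_on with
  | empty => simp
  | insert a s has ih =>
    have ha := h a (Finset.mem_insert_self a s)
    have hs := ih fun i hi => h i (Finset.mem_insert_of_mem hi)
    rw [Finset.lcm_insert]
    change Squarefree (Nat.lcm _ _)
    rw [Nat.squarefree_iff_factorization_le_one (Nat.lcm_ne_zero ha.ne_zero hs.ne_zero)]
    intro p
    rw [Nat.factorization_lcm ha.ne_zero hs.ne_zero, Finsupp.sup_apply]
    exact sup_le (ha.natFactorization_le_one p) (hs.natFactorization_le_one p)

/-- The indicator function of the squarefree numbers. -/
noncomputable def squarefreeIndicator (n : ℕ) : ℝ :=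
  ((ArithmeticFunction.moebius n : ℤ) : ℝ) ^ 2

theorem squarefreeIndicator_eq_ite (n : ℕ) [Decidable (Squarefree n)] :
    squarefreeIndicator n = if Squarefree n then 1 else 0 := by
  unfold squarefreeIndicator
  have := ArithmeticFunction.moebius_sq (n := n)
  have h2 : ((ArithmeticFunction.moebius n : ℤ) : ℝ) ^ 2
    = ((ArithmeticFunction.moebius n ^ 2 : ℤ) : ℝ) := by push_cast; rfl
  rw [h2, this]
  split_ifs <;> simp

theorem squarefreeIndicator_nonneg (n : ℕ) : 0 ≤ squarefreeIndicator n := sq_nonneg _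

theorem squarefreeIndicator_le_one (n : ℕ) : squarefreeIndicator n ≤ 1 := by
  classical
  rw [squarefreeIndicator_eq_ite]; split_ifs <;> simp

theorem squarefreeIndicator_lcm {ι : Type*} [Fintype ι] (n : ι → ℕ) :
    squarefreeIndicator (Finset.univ.lcm n) = ∏ i, squarefreeIndicator (n i) := by
  classical
  simp only [squarefreeIndicator_eq_ite, Nat.squarefree_finset_lcm_iff]
  rw [Finset.prod_ite_zero]
  simp

/-- At each prime, `2v(d) ≤ 2v(a) + 1` forces `v(d) ≤ v(a)`. -/
theorem Nat.dvd_of_sq_dvd_sq_mul_squarefree {a b d : ℕ} (ha : a ≠ 0) (hb : Squarefree b)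
    (h : d ^ 2 ∣ a ^ 2 * b) : d ∣ a := by
  have hab : a ^ 2 * b ≠ 0 := mul_ne_zero (pow_ne_zero _ ha) hb.ne_zero
  have hd : d ≠ 0 := by
    rintro rfl
    exact hab (by simpa using h)
  rw [← Nat.factorization_le_iff_dvd hd ha]
  rw [← Nat.factorization_le_iff_dvd (pow_ne_zero _ hd) hab] at h
  intro p
  have h1 := h p
  have h2 := hb.natFactorization_le_one p
  rw [Nat.factorization_mul (pow_ne_zero _ ha) hb.ne_zero, Nat.factorization_pow,
    Nat.factorization_pow] at h1
  simp only [Finsupp.coe_add, Finsupp.coe_smul, Pi.add_apply, Pi.smul_apply, smul_eq_mul] at h1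
  omega

/-- Write `n = a²b` with `b` squarefree: then `d² ∣ n` iff `d ∣ a`, and the Möbius sum over divisors
of `a` detects `a = 1`. A cutoff `N` chosen independently of `n` lets sums over `n` and `d` be
exchanged. -/
theorem squarefreeIndicator_eq_sum_moebius {n N : ℕ} (hn : n ≠ 0) (hN : n ≤ N ^ 2) :
    squarefreeIndicator n = ∑ d ∈ Finset.Ioc 0 N,
      if d ^ 2 ∣ n then ((ArithmeticFunction.moebius d : ℤ) : ℝ) else 0 := by
  classical
  obtain ⟨b, a, rfl, hb⟩ := Nat.sq_mul_squarefree n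
  have ha : a ≠ 0 := by rintro rfl; simp at hn
  have hset : (Finset.Ioc 0 N).filter (fun d => d ^ 2 ∣ a ^ 2 * b) = a.divisors := by
    ext d
    simp only [Finset.mem_filter, Finset.mem_Ioc, Nat.mem_divisors]
    constructor
    · rintro ⟨-, h⟩
      exact ⟨Nat.dvd_of_sq_dvd_sq_mul_squarefree ha hb h, ha⟩
    · rintro ⟨h, -⟩
      have hdvd : d ^ 2 ∣ a ^ 2 * b := (pow_dvd_pow_of_dvd h 2).mul_right b
      refine ⟨⟨Nat.pos_of_dvd_of_pos h (Nat.pos_of_ne_zero ha), ?_⟩, hdvd⟩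
      have := (Nat.le_of_dvd (Nat.pos_of_ne_zero hn) hdvd).trans hN
      exact (Nat.pow_le_pow_iff_left two_ne_zero).1 this
  rw [← Finset.sum_filter, hset, squarefreeIndicator_eq_ite]
  have hs : Squarefree (a ^ 2 * b) ↔ a = 1 := by
    refine ⟨fun h => ?_, by rintro rfl; simpa using hb⟩
    exact Nat.isUnit_iff.1 (h a ⟨b, by ring⟩)
  have hmu : ∑ d ∈ a.divisors, ArithmeticFunction.moebius d = if a = 1 then 1 else 0 := by
    rw [← ArithmeticFunction.coe_mul_zeta_apply, ArithmeticFunction.moebius_mul_coe_zeta,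
      ArithmeticFunction.one_apply]
  simp only [hs]
  rw [← Int.cast_sum, hmu]
  split_ifs <;> simp

/-! ### Density of the squarefree numbers. -/

theorem zetaTwo_eq : zetaTwo = Real.pi ^ 2 / 6 := by
  have h := ofReal_zetaTwo
  rw [riemannZeta_two] at h
  exact_mod_cast h

theorem zetaTwo_pos : 0 < zetaTwo := by
  rw [zetaTwo_eq]; positivity

theorem hasSum_moebius_div_sq :
    HasSum (fun d : ℕ => ((ArithmeticFunction.moebius d : ℤ) : ℝ) / (d : ℝ) ^ 2) zetaTwo⁻¹ := by
  have hs : (1 : ℝ) < (2 : ℂ).re := by norm_num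
  have h := (ArithmeticFunction.LSeriesSummable_moebius_iff.2 hs).LSeriesHasSum
  have hv := ArithmeticFunction.LSeries_zeta_mul_Lseries_moebius hs
  rw [ArithmeticFunction.LSeries_zeta_eq_riemannZeta hs, ← ofReal_zetaTwo] at hv
  rw [eq_inv_of_mul_eq_one_right hv, ← Complex.ofReal_inv] at h
  rw [← Complex.hasSum_ofReal]
  have hterm : (fun d : ℕ => ((((ArithmeticFunction.moebius d : ℤ) : ℝ) / (d : ℝ) ^ 2 : ℝ) : ℂ))
      = LSeries.term (fun n => ((ArithmeticFunction.moebius n : ℤ) : ℂ)) 2 := by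
    funext d
    rw [LSeries.term_def₀ (by simp), div_eq_mul_inv, Complex.cpow_neg,
      Complex.cpow_ofNat]
    push_cast
    rfl
  rw [hterm]
  exact h

theorem abs_sum_moebius_div_sq_sub_le {N : ℕ} (hN : N ≠ 0) :
    |∑ d ∈ Finset.Ioc 0 N, ((ArithmeticFunction.moebius d : ℤ) : ℝ) / (d : ℝ) ^ 2 - zetaTwo⁻¹|
      ≤ (N : ℝ)⁻¹ := by
  have h : Filter.Tendsto (fun m : ℕ =>
      |∑ d ∈ Finset.Ioc 0 N, ((ArithmeticFunction.moebius d : ℤ) : ℝ) / (d : ℝ) ^ 2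
        - ∑ d ∈ Finset.range (m + 1), ((ArithmeticFunction.moebius d : ℤ) : ℝ) / (d : ℝ) ^ 2|)
      Filter.atTop (nhds |∑ d ∈ Finset.Ioc 0 N,
        ((ArithmeticFunction.moebius d : ℤ) : ℝ) / (d : ℝ) ^ 2 - zetaTwo⁻¹|) :=
    (tendsto_const_nhds.sub ((Filter.tendsto_add_atTop_iff_nat 1).2
      hasSum_moebius_div_sq.tendsto_sum_nat)).abs
  refine le_of_tendsto h (Filter.eventually_atTop.2 ⟨N, fun m hm => ?_⟩)
  have hr : ∑ d ∈ Finset.range (m + 1), ((ArithmeticFunction.moebius d : ℤ) : ℝ) / (d : ℝ) ^ 2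
      = ∑ d ∈ Finset.Ioc 0 N, ((ArithmeticFunction.moebius d : ℤ) : ℝ) / (d : ℝ) ^ 2
        + ∑ d ∈ Finset.Ioc N m, ((ArithmeticFunction.moebius d : ℤ) : ℝ) / (d : ℝ) ^ 2 := by
    rw [Finset.sum_Ioc_consecutive _ (Nat.zero_le N) hm, Finset.sum_range_succ',
      Finset.range_eq_Ico, Finset.sum_Ico_add' (fun d : ℕ =>
        ((ArithmeticFunction.moebius d : ℤ) : ℝ) / (d : ℝ) ^ 2) 0 m 1]
    simp only [Nat.cast_zero, ArithmeticFunction.map_zero, Int.cast_zero, zero_div, add_zero]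
    rfl
  rw [hr, sub_add_cancel_left, abs_neg]
  calc _ ≤ ∑ d ∈ Finset.Ioc N m, ((d : ℝ) ^ 2)⁻¹ := by
        refine (Finset.abs_sum_le_sum_abs _ _).trans (Finset.sum_le_sum fun d _ => ?_)
        rw [abs_div, abs_of_nonneg (sq_nonneg (d : ℝ)), div_eq_mul_inv]
        refine mul_le_of_le_one_left (by positivity) ?_
        exact_mod_cast ArithmeticFunction.abs_moebius_le_one
    _ ≤ (N : ℝ)⁻¹ - (m : ℝ)⁻¹ := sum_Ioc_inv_sq_le_sub hN hm
    _ ≤ (N : ℝ)⁻¹ := sub_le_self _ (by positivity)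

/-- The number of squarefree integers up to `n` is `n / ζ(2) + O(√n)`. -/
theorem abs_sum_squarefreeIndicator_sub_le (n : ℕ) :
    |∑ i ∈ Finset.range n, (squarefreeIndicator (i + 1) - zetaTwo⁻¹)| ≤ 4 * √(n : ℝ) := by
  rcases Nat.eq_zero_or_pos n with rfl | hn
  · simp
  set D := Nat.sqrt n with hD
  have hD1 : 1 ≤ D := Nat.sqrt_pos.2 hn
  have hn1 : n ≤ D * D + D + D := Nat.sqrt_le_add n
  have hcount : ∑ i ∈ Finset.range n, squarefreeIndicator (i + 1)
      = ∑ d ∈ Finset.Ioc 0 D, ((ArithmeticFunction.moebius d : ℤ) : ℝ) * ((n / d ^ 2 : ℕ) : ℝ) := by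
    have : ∀ i ∈ Finset.range n, squarefreeIndicator (i + 1) = ∑ d ∈ Finset.Ioc 0 n,
        if d ^ 2 ∣ i + 1 then ((ArithmeticFunction.moebius d : ℤ) : ℝ) else 0 := fun i hi =>
      squarefreeIndicator_eq_sum_moebius i.succ_ne_zero
        ((Nat.succ_le_of_lt (Finset.mem_range.1 hi)).trans (Nat.le_self_pow two_ne_zero n))
    rw [Finset.sum_congr rfl this, Finset.sum_comm]
    have hterm : ∀ d, (∑ i ∈ Finset.range n,
        if d ^ 2 ∣ i + 1 then ((ArithmeticFunction.moebius d : ℤ) : ℝ) else 0)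
        = ((ArithmeticFunction.moebius d : ℤ) : ℝ) * ((n / d ^ 2 : ℕ) : ℝ) := by
      intro d
      rw [← Finset.sum_filter, Finset.sum_const, Nat.card_multiples, nsmul_eq_mul, mul_comm]
    rw [Finset.sum_congr rfl fun d _ => hterm d]
    symm
    -- For `√n < d ≤ n` the quotient `n / d ^ 2` is zero.
    refine Finset.sum_subset (Finset.Ioc_subset_Ioc_right (Nat.sqrt_le_self n)) fun d hd hd' => ?_
    rw [Finset.mem_Ioc] at hd hd'
    have : n < d ^ 2 := by
      rw [pow_two]
      exact Nat.sqrt_lt.1 (by omega)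
    rw [Nat.div_eq_of_lt this]
    simp
  have hround : |∑ d ∈ Finset.Ioc 0 D, ((ArithmeticFunction.moebius d : ℤ) : ℝ) *
      ((n / d ^ 2 : ℕ) : ℝ) - n * ∑ d ∈ Finset.Ioc 0 D,
        ((ArithmeticFunction.moebius d : ℤ) : ℝ) / (d : ℝ) ^ 2| ≤ D := by
    rw [Finset.mul_sum, ← Finset.sum_sub_distrib]
    refine (Finset.abs_sum_le_sum_abs _ _).trans ?_
    have hb : ∀ d ∈ Finset.Ioc 0 D, |((ArithmeticFunction.moebius d : ℤ) : ℝ) *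
        ((n / d ^ 2 : ℕ) : ℝ) - n * (((ArithmeticFunction.moebius d : ℤ) : ℝ) / (d : ℝ) ^ 2)|
        ≤ 1 := by
      intro d hd
      have h1 : ((n / d ^ 2 : ℕ) : ℝ) ≤ (n : ℝ) / (d : ℝ) ^ 2 := by
        exact_mod_cast Nat.cast_div_le (α := ℝ) (m := n) (n := d ^ 2)
      have h2 : (n : ℝ) / (d : ℝ) ^ 2 ≤ ((n / d ^ 2 : ℕ) : ℝ) + 1 := by
        have := Nat.lt_floor_add_one ((n : ℝ) / ((d ^ 2 : ℕ) : ℝ))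
        rw [Nat.floor_div_natCast, Nat.floor_natCast] at this
        exact_mod_cast this.le
      have h3 : |((ArithmeticFunction.moebius d : ℤ) : ℝ)| ≤ 1 := by
        exact_mod_cast ArithmeticFunction.abs_moebius_le_one
      have h4 : ((ArithmeticFunction.moebius d : ℤ) : ℝ) *
          ((n / d ^ 2 : ℕ) : ℝ) - n * (((ArithmeticFunction.moebius d : ℤ) : ℝ) / (d : ℝ) ^ 2)
          = ((ArithmeticFunction.moebius d : ℤ) : ℝ) *
            (((n / d ^ 2 : ℕ) : ℝ) - (n : ℝ) / (d : ℝ) ^ 2) := by ring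
      rw [h4, abs_mul]
      exact mul_le_one₀ h3 (abs_nonneg _) (abs_le.2 ⟨by linarith, by linarith⟩)
    refine (Finset.sum_le_sum hb).trans (by simp)
  have htail := mul_le_mul_of_nonneg_left (abs_sum_moebius_div_sq_sub_le (N := D) (by omega))
    (Nat.cast_nonneg (α := ℝ) n)
  have hDpos : (1 : ℝ) ≤ D := by exact_mod_cast hD1
  -- The tail costs `n/D ≤ D + 2 ≤ 3D` and the rounding costs `D`, whence the constant 4.
  have hnD : (n : ℝ) * (D : ℝ)⁻¹ ≤ 3 * D := by
    have : (n : ℝ) ≤ D * D + D + D := by exact_mod_cast hn1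
    rw [← div_eq_mul_inv, div_le_iff₀ (by linarith)]
    nlinarith
  have hDn : (D : ℝ) ≤ √(n : ℝ) := Real.nat_sqrt_le_real_sqrt
  rw [Finset.sum_sub_distrib, hcount, Finset.sum_const, Finset.card_range, nsmul_eq_mul]
  rw [← abs_of_nonneg (Nat.cast_nonneg (α := ℝ) n), ← abs_mul,
    abs_of_nonneg (Nat.cast_nonneg (α := ℝ) n)] at htail
  rw [abs_le] at *
  constructor <;> linarith [hround.1, hround.2, htail.1, htail.2]

/-! ### Partial summation and integral comparison. -/

/-- A summation by parts bound for the product of a nonnegative antitone sequence with a sequence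
whose partial sums are bounded. -/
theorem abs_sum_range_mul_le_of_antitone {f b : ℕ → ℝ} {E : ℝ} (N : ℕ) (hf : Antitone f)
    (hf0 : ∀ i, 0 ≤ f i) (hE : ∀ n ≤ N, |∑ i ∈ Finset.range n, b i| ≤ E) :
    |∑ i ∈ Finset.range N, f i * b i| ≤ E * f 0 := by
  have hparts : ∀ n, ∑ i ∈ Finset.range n, f i * b i
      = f n * ∑ i ∈ Finset.range n, b i
        + ∑ i ∈ Finset.range n, (f i - f (i + 1)) * ∑ j ∈ Finset.range (i + 1), b j := by
    intro n
    induction n with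
    | zero => simp
    | succ n ih =>
      rw [Finset.sum_range_succ, ih, Finset.sum_range_succ (fun i => (f i - f (i + 1)) * _),
        Finset.sum_range_succ b]
      ring
  rw [hparts N]
  calc _ ≤ f N * E + ∑ i ∈ Finset.range N, (f i - f (i + 1)) * E := by
        refine (abs_add_le _ _).trans (add_le_add ?_ ((Finset.abs_sum_le_sum_abs _ _).trans
          (Finset.sum_le_sum fun i hi => ?_)))
        · rw [abs_mul, abs_of_nonneg (hf0 N)]
          exact mul_le_mul_of_nonneg_left (hE N le_rfl) (hf0 N)
        · have h : 0 ≤ f i - f (i + 1) := sub_nonneg.2 (hf i.le_succ)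
          rw [abs_mul, abs_of_nonneg h]
          exact mul_le_mul_of_nonneg_left (hE _ (Finset.mem_range.1 hi)) h
    _ = E * f 0 := by
        rw [← Finset.sum_mul, Finset.sum_range_sub']
        ring

/-- Comparison of the integral over `[0, a]` of a nonnegative antitone function
with the sum of its values at the integers in `(0, a]`. -/
theorem abs_sum_range_sub_integral_le {f : ℝ → ℝ} (hf : AntitoneOn f (Set.Ici 0))
    (hf0 : ∀ t, 0 ≤ f t) {a : ℝ} (ha : 0 ≤ a) :
    |∑ i ∈ Finset.range ⌊a⌋₊, f ((i + 1 : ℕ) : ℝ) - ∫ t in (0 : ℝ)..a, f t| ≤ f 0 := by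
  set N := ⌊a⌋₊
  have hint : ∀ b c : ℝ, 0 ≤ b → 0 ≤ c → IntervalIntegrable f MeasureTheory.volume b c := by
    intro b c hb hc
    exact (hf.mono (fun t ht => (le_min hb hc).trans ht.1)).intervalIntegrable
  have hNa : (N : ℝ) ≤ a := Nat.floor_le ha
  have haN : a ≤ ((N + 1 : ℕ) : ℝ) := by push_cast; exact (Nat.lt_floor_add_one a).le
  have h1 := AntitoneOn.sum_le_integral (f := f) (x₀ := 0) (a := N)
    (hf.mono fun t ht => ht.1)
  have h2 := AntitoneOn.integral_le_sum (f := f) (x₀ := 0) (a := N + 1)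
    (hf.mono fun t ht => ht.1)
  simp only [zero_add] at h1 h2
  -- Splitting off the term at 0 leaves the sum over positive integers; this term is the whole
  -- error.
  rw [Finset.sum_range_succ'] at h2
  have h3 : (∫ t in (0 : ℝ)..N, f t) ≤ ∫ t in (0 : ℝ)..a, f t :=
    intervalIntegral.integral_mono_interval le_rfl (Nat.cast_nonneg N) hNa
      (Filter.Eventually.of_forall hf0) (hint _ _ le_rfl ha)
  have h4 : (∫ t in (0 : ℝ)..a, f t) ≤ ∫ t in (0 : ℝ)..((N + 1 : ℕ) : ℝ), f t :=
    intervalIntegral.integral_mono_interval le_rfl ha haN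
      (Filter.Eventually.of_forall hf0) (hint _ _ le_rfl (Nat.cast_nonneg _))
  simp only [Nat.cast_zero] at h2
  have := hf0 0
  rw [abs_le]
  constructor <;> linarith

/-! ### Recursion for the volume of the unit ball. -/

theorem integral_one_sub_sq_rpow (k : ℕ) :
    ∫ u in (0 : ℝ)..1, (1 - u ^ 2) ^ ((k : ℝ) / 2)
      = ∫ θ in (0 : ℝ)..(Real.pi / 2), Real.cos θ ^ (k + 1) := by
  have hc : Continuous fun u : ℝ => (1 - u ^ 2) ^ ((k : ℝ) / 2) :=
    (by fun_prop : Continuous fun u : ℝ => 1 - u ^ 2).rpow_const fun _ => Or.inr (by positivity)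
  have h := intervalIntegral.integral_comp_mul_deriv (a := 0) (b := Real.pi / 2)
    (f := Real.sin) (f' := Real.cos) (g := fun u : ℝ => (1 - u ^ 2) ^ ((k : ℝ) / 2))
    (fun x _ => Real.hasDerivAt_sin x) Real.continuous_cos.continuousOn hc
  rw [Real.sin_zero, Real.sin_pi_div_two] at h
  rw [← h]
  refine intervalIntegral.integral_congr fun θ hθ => ?_
  rw [Set.uIcc_of_le (by positivity)] at hθ
  have h0 : 0 ≤ Real.cos θ :=
    Real.cos_nonneg_of_mem_Icc ⟨by linarith [hθ.1, Real.pi_pos], hθ.2⟩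
  have h2 : (1 - Real.sin θ ^ 2) ^ ((k : ℝ) / 2) = Real.cos θ ^ k := by
    rw [← Real.cos_sq', ← Real.rpow_natCast, ← Real.rpow_mul h0, ← Real.rpow_natCast]
    congr 1
    push_cast; ring
  simp only [Function.comp, h2]
  rw [pow_succ]

/-- The reduction formula for powers of cosine matches `Γ(s + 1) = sΓ(s)`, both moving `k` by 2. -/
theorem integral_cos_pow_mul_Gamma (k : ℕ) :
    (∫ θ in (0 : ℝ)..(Real.pi / 2), Real.cos θ ^ (k + 1)) * Real.Gamma ((k + 1 : ℝ) / 2 + 1)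
      = √Real.pi / 2 * Real.Gamma ((k : ℝ) / 2 + 1) := by
  induction k using Nat.twoStepInduction with
  | zero =>
    have h : Real.Gamma (1 / 2 + 1) = 1 / 2 * √Real.pi := by
      rw [Real.Gamma_add_one (by norm_num), Real.Gamma_one_half_eq]
    norm_num [integral_cos] at h ⊢
    linarith
  | one =>
    have h : Real.Gamma (1 / 2 + 1) = 1 / 2 * √Real.pi := by
      rw [Real.Gamma_add_one (by norm_num), Real.Gamma_one_half_eq]
    have h2 : Real.Gamma (((1 : ℕ) + 1 : ℝ) / 2 + 1) = 1 := by norm_num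
    rw [h2, Nat.cast_one, h]
    have := Real.mul_self_sqrt Real.pi_pos.le
    norm_num [integral_cos_sq]
    nlinarith
  | more k ih _ =>
    have e1 : (((k + 2 : ℕ) : ℝ) + 1) / 2 + 1 = ((k + 1 : ℝ) / 2 + 1) + 1 := by push_cast; ring
    have e2 : ((k + 2 : ℕ) : ℝ) / 2 + 1 = ((k : ℝ) / 2 + 1) + 1 := by push_cast; ring
    rw [e1, e2, Real.Gamma_add_one (s := (k + 1 : ℝ) / 2 + 1) (by positivity),
      Real.Gamma_add_one (s := (k : ℝ) / 2 + 1) (by positivity),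
      show k + 2 + 1 = (k + 1) + 2 by ring, integral_cos_pow]
    simp only [Real.cos_pi_div_two, Real.sin_zero, mul_zero, sub_zero]
    have hk : (k : ℝ) + 1 + 2 ≠ 0 := by positivity
    push_cast
    rw [zero_pow (by omega)]
    generalize Real.Gamma ((k + 1 : ℝ) / 2 + 1) = g at *
    generalize Real.Gamma ((k : ℝ) / 2 + 1) = g' at *
    field_simp
    linear_combination (k + 2 : ℝ) * ih * 2

theorem unitBallVolume_succ (k : ℕ) :
    unitBallVolume (k + 1)
      = 2 * (∫ u in (0 : ℝ)..1, (1 - u ^ 2) ^ ((k : ℝ) / 2)) * unitBallVolume k := by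
  have h := integral_cos_pow_mul_Gamma k
  rw [← integral_one_sub_sq_rpow] at h
  have h1 : Real.Gamma ((k + 1 : ℝ) / 2 + 1) ≠ 0 := (Real.Gamma_pos_of_pos (by positivity)).ne'
  have h2 : Real.Gamma ((k : ℝ) / 2 + 1) ≠ 0 := (Real.Gamma_pos_of_pos (by positivity)).ne'
  have hpi : Real.pi ^ ((k + 1 : ℝ) / 2) = Real.pi ^ ((k : ℝ) / 2) * √Real.pi := by
    rw [add_div, Real.rpow_add Real.pi_pos, Real.sqrt_eq_rpow]
  unfold unitBallVolume
  push_cast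
  rw [hpi, ← mul_div_assoc, div_eq_div_iff h1 h2]
  linear_combination (-2 * Real.pi ^ ((k : ℝ) / 2)) * h

/-- Rescaling by `t = √x u`. The truncation by `max` keeps the weight nonnegative and antitone on
the whole half-line. -/
theorem integral_max_sub_sq_rpow (k : ℕ) {x : ℝ} (hx : 0 < x) :
    ∫ t in (0 : ℝ)..√x, max (x - t ^ 2) 0 ^ ((k : ℝ) / 2)
      = x ^ ((k : ℝ) / 2 + 1 / 2) * ∫ u in (0 : ℝ)..1, (1 - u ^ 2) ^ ((k : ℝ) / 2) := by
  have h := intervalIntegral.smul_integral_comp_mul_left (a := 0) (b := 1)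
    (fun t : ℝ => max (x - t ^ 2) 0 ^ ((k : ℝ) / 2)) √x
  rw [mul_zero, mul_one] at h
  rw [← h, Real.rpow_add hx, ← Real.sqrt_eq_rpow, mul_comm (x ^ _), mul_assoc, smul_eq_mul,
    ← intervalIntegral.integral_const_mul (x ^ ((k : ℝ) / 2))]
  congr 1
  refine intervalIntegral.integral_congr fun u hu => ?_
  rw [Set.uIcc_of_le zero_le_one] at hu
  have hu1 : 0 ≤ 1 - u ^ 2 := by nlinarith [hu.1, hu.2]
  have hxu : x - (√x * u) ^ 2 = x * (1 - u ^ 2) := by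
    rw [mul_pow, Real.sq_sqrt hx.le]; ring
  rw [hxu, max_eq_left (mul_nonneg hx.le hu1), Real.mul_rpow hx.le hu1]

/-- The 4 comes from partial summation against the deviation of the indicator from its mean, the
`zetaTwo⁻¹` from replacing the sum of weights by its integral. -/
theorem abs_sum_squarefreeIndicator_mul_rpow_sub_le (k : ℕ) {x : ℝ} (hx : 1 ≤ x) :
    |∑ i ∈ Finset.range ⌊√x⌋₊, squarefreeIndicator (i + 1) *
        max (x - ((i + 1 : ℕ) : ℝ) ^ 2) 0 ^ ((k : ℝ) / 2)
      - zetaTwo⁻¹ * (x ^ ((k : ℝ) / 2 + 1 / 2) *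
        ∫ u in (0 : ℝ)..1, (1 - u ^ 2) ^ ((k : ℝ) / 2))|
      ≤ (4 + zetaTwo⁻¹) * x ^ ((k : ℝ) / 2 + 1 / 4) := by
  have hx0 : 0 < x := one_pos.trans_le hx
  set f : ℝ → ℝ := fun t => max (x - t ^ 2) 0 ^ ((k : ℝ) / 2) with hf
  have hanti : AntitoneOn f (Set.Ici 0) := by
    intro s hs t ht hst
    refine Real.rpow_le_rpow (le_max_right _ _) (max_le_max_right _ ?_) (by positivity)
    have := pow_le_pow_left₀ (Set.mem_Ici.1 hs) hst 2
    linarith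
  have hnonneg : ∀ t, 0 ≤ f t := fun t => Real.rpow_nonneg (le_max_right _ _) _
  have hf0 : f 0 = x ^ ((k : ℝ) / 2) := by
    simp only [hf]
    rw [zero_pow two_ne_zero, sub_zero, max_eq_left hx0.le]
  have hmono : x ^ ((k : ℝ) / 2) ≤ x ^ ((k : ℝ) / 2 + 1 / 4) :=
    Real.rpow_le_rpow_of_exponent_le hx (by linarith)
  have hcmp := abs_sum_range_sub_integral_le hanti hnonneg (Real.sqrt_nonneg x)
  rw [integral_max_sub_sq_rpow k hx0, hf0] at hcmp
  have hquarter : √((⌊√x⌋₊ : ℕ) : ℝ) ≤ x ^ (1 / 4 : ℝ) := by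
    calc √((⌊√x⌋₊ : ℕ) : ℝ) ≤ √(√x) := Real.sqrt_le_sqrt (Nat.floor_le (Real.sqrt_nonneg x))
      _ = x ^ (1 / 4 : ℝ) := by
        rw [Real.sqrt_eq_rpow, Real.sqrt_eq_rpow, ← Real.rpow_mul hx0.le]; norm_num
  have habel := abs_sum_range_mul_le_of_antitone (f := fun i : ℕ => f ((i + 1 : ℕ) : ℝ))
    (b := fun i => squarefreeIndicator (i + 1) - zetaTwo⁻¹) (E := 4 * x ^ (1 / 4 : ℝ)) ⌊√x⌋₊
    (fun i j hij => hanti (Set.mem_Ici.2 (Nat.cast_nonneg _)) (Set.mem_Ici.2 (Nat.cast_nonneg _))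
      (by exact_mod_cast Nat.succ_le_succ hij)) (fun i => hnonneg _)
    (fun n hn => (abs_sum_squarefreeIndicator_sub_le n).trans
      (mul_le_mul_of_nonneg_left ((Real.sqrt_le_sqrt (by exact_mod_cast hn)).trans hquarter)
        (by norm_num)))
  have hf1 : f ((0 + 1 : ℕ) : ℝ) ≤ x ^ ((k : ℝ) / 2) := by
    rw [← hf0]
    exact hanti (Set.mem_Ici.2 le_rfl) (Set.mem_Ici.2 (Nat.cast_nonneg _)) (Nat.cast_nonneg _)
  have habel' := habel.trans (mul_le_mul_of_nonneg_left hf1 (by positivity))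
  rw [mul_assoc, mul_comm (x ^ (1 / 4 : ℝ)), ← Real.rpow_add hx0] at habel'
  have hcmp' := mul_le_mul_of_nonneg_left (hcmp.trans hmono) (inv_nonneg.2 zetaTwo_pos.le)
  rw [← abs_of_nonneg (inv_nonneg.2 zetaTwo_pos.le), ← abs_mul,
    abs_of_nonneg (inv_nonneg.2 zetaTwo_pos.le)] at hcmp'
  calc _ = |∑ i ∈ Finset.range ⌊√x⌋₊, f ((i + 1 : ℕ) : ℝ) *
          (squarefreeIndicator (i + 1) - zetaTwo⁻¹)
        + zetaTwo⁻¹ * (∑ i ∈ Finset.range ⌊√x⌋₊, f ((i + 1 : ℕ) : ℝ)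
          - x ^ ((k : ℝ) / 2 + 1 / 2) *
            ∫ u in (0 : ℝ)..1, (1 - u ^ 2) ^ ((k : ℝ) / 2))| := by
        congr 1
        simp only [mul_sub, Finset.sum_sub_distrib, ← Finset.sum_mul]
        simp only [mul_comm (squarefreeIndicator _)]
        ring
    _ ≤ _ := (abs_add_le _ _).trans (by linarith)

/-! ### Induction on the dimension. -/

/-- The number of points of `positiveBallPoints k x` with squarefree coordinates. -/
noncomputable def squarefreeBallCount (k : ℕ) (x : ℝ) : ℝ :=
  ∑ n ∈ positiveBallPoints k x, ∏ i, squarefreeIndicator (n i)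

theorem squarefreeBallCount_zero {x : ℝ} (hx : 0 ≤ x) : squarefreeBallCount 0 x = 1 := by
  have h : positiveBallPoints 0 x = Finset.univ := by
    ext n
    simpa [mem_positiveBallPoints, hx] using Subsingleton.elim _ _
  simp [squarefreeBallCount, h]

theorem squarefreeBallCount_succ (k : ℕ) (x : ℝ) :
    squarefreeBallCount (k + 1) x = ∑ i ∈ Finset.range ⌊√x⌋₊,
      squarefreeIndicator (i + 1) * squarefreeBallCount k (x - ((i + 1 : ℕ) : ℝ) ^ 2) := by
  simp only [squarefreeBallCount, Finset.mul_sum]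
  rw [Finset.sum_sigma']
  symm
  refine Finset.sum_bij' (fun p _ => Fin.cons (p.1 + 1) p.2) (fun n _ => ⟨n 0 - 1, Fin.tail n⟩)
    ?_ ?_ ?_ ?_ ?_
  · rintro ⟨i, n⟩ h
    rw [Finset.mem_sigma, mem_positiveBallPoints] at h
    rw [mem_positiveBallPoints, Fin.sum_univ_succ, Fin.forall_fin_succ]
    simp only [Fin.cons_zero, Fin.cons_succ]
    exact ⟨⟨by omega, h.2.1⟩, by linarith [h.2.2]⟩
  · intro n h
    rw [mem_positiveBallPoints, Fin.sum_univ_succ, Fin.forall_fin_succ] at h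
    obtain ⟨⟨h0, h1⟩, h2⟩ := h
    have h3 : n 0 - 1 + 1 = n 0 := by omega
    have h4 : n 0 ≤ ⌊√x⌋₊ := Nat.le_floor (Real.le_sqrt_of_sq_le (by
      have : 0 ≤ ∑ i : Fin k, (n i.succ : ℝ) ^ 2 := Finset.sum_nonneg fun _ _ => sq_nonneg _
      linarith))
    rw [Finset.mem_sigma, mem_positiveBallPoints, Finset.mem_range]
    simp only [h3, Fin.tail]
    exact ⟨by omega, h1, by linarith⟩
  · rintro ⟨i, n⟩ _
    simp
  · intro n h
    have h0 := (mem_positiveBallPoints.1 h).1 0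
    simp only [Nat.sub_add_cancel h0, Fin.cons_self_tail]
  · rintro ⟨i, n⟩ _
    simp [Fin.prod_univ_succ]

theorem squarefreeBallCount_succ_eq_zero (k : ℕ) {x : ℝ} (hx : x < 1) :
    squarefreeBallCount (k + 1) x = 0 := by
  have h : ⌊√x⌋₊ = 0 := Nat.floor_eq_zero.2 (by
    rw [Real.sqrt_lt' one_pos]; simpa using hx)
  rw [squarefreeBallCount_succ, h, Finset.sum_range_zero]

theorem unitBallVolume_pos (k : ℕ) : 0 < unitBallVolume k :=
  div_pos (Real.rpow_pos_of_pos Real.pi_pos _) (Real.Gamma_pos_of_pos (by positivity))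

theorem exists_abs_squarefreeBallCount_succ_sub_le {k : ℕ} {C : ℝ} (hC : 0 ≤ C)
    (h : ∀ x y : ℝ, 1 ≤ x → 0 ≤ y → y ≤ x →
      |squarefreeBallCount k y - unitBallVolume k / (2 * zetaTwo) ^ k * y ^ ((k : ℝ) / 2)|
        ≤ C * x ^ ((k : ℝ) / 2 - 1 / 4)) :
    ∃ C' : ℝ, ∀ x : ℝ, 1 ≤ x →
      |squarefreeBallCount (k + 1) x
          - unitBallVolume (k + 1) / (2 * zetaTwo) ^ (k + 1) * x ^ ((k : ℝ) / 2 + 1 / 2)|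
        ≤ C' * x ^ ((k : ℝ) / 2 + 1 / 4) := by
  set c := unitBallVolume k / (2 * zetaTwo) ^ k with hc
  have hc0 : 0 ≤ c := (div_pos (unitBallVolume_pos k) (pow_pos (by linarith [zetaTwo_pos]) _)).le
  refine ⟨C + c * (4 + zetaTwo⁻¹), fun x hx => ?_⟩
  have hx0 : 0 < x := one_pos.trans_le hx
  set I := ∫ u in (0 : ℝ)..1, (1 - u ^ 2) ^ ((k : ℝ) / 2) with hI
  have hconst : unitBallVolume (k + 1) / (2 * zetaTwo) ^ (k + 1) = c * (zetaTwo⁻¹ * I) := by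
    have := zetaTwo_pos.ne'
    rw [unitBallVolume_succ, hc, ← hI, pow_succ]
    field_simp
  have hmain := mul_le_mul_of_nonneg_left (abs_sum_squarefreeIndicator_mul_rpow_sub_le k hx) hc0
  rw [← abs_of_nonneg hc0, ← abs_mul, abs_of_nonneg hc0, ← hI] at hmain
  have hsq : ∀ i ∈ Finset.range ⌊√x⌋₊, 0 ≤ x - ((i + 1 : ℕ) : ℝ) ^ 2 := by
    intro i hi
    have h1 : ((i + 1 : ℕ) : ℝ) ≤ √x :=
      (Nat.le_floor_iff (Real.sqrt_nonneg x)).1 (Finset.mem_range.1 hi)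
    have h2 := (Real.le_sqrt (Nat.cast_nonneg _) hx0.le).1 h1
    linarith
  have herr : |∑ i ∈ Finset.range ⌊√x⌋₊, squarefreeIndicator (i + 1) *
      (squarefreeBallCount k (x - ((i + 1 : ℕ) : ℝ) ^ 2)
        - c * max (x - ((i + 1 : ℕ) : ℝ) ^ 2) 0 ^ ((k : ℝ) / 2))|
      ≤ C * x ^ ((k : ℝ) / 2 + 1 / 4) := by
    calc _ ≤ ∑ i ∈ Finset.range ⌊√x⌋₊, C * x ^ ((k : ℝ) / 2 - 1 / 4) := by
          refine (Finset.abs_sum_le_sum_abs _ _).trans (Finset.sum_le_sum fun i hi => ?_)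
          rw [abs_mul, abs_of_nonneg (squarefreeIndicator_nonneg _), max_eq_left (hsq i hi)]
          refine (mul_le_of_le_one_left (abs_nonneg _) (squarefreeIndicator_le_one _)).trans ?_
          exact h x _ hx (hsq i hi) (sub_le_self _ (sq_nonneg _))
      _ = ⌊√x⌋₊ * (C * x ^ ((k : ℝ) / 2 - 1 / 4)) := by
          rw [Finset.sum_const, Finset.card_range, nsmul_eq_mul]
      _ ≤ x ^ (1 / 2 : ℝ) * (C * x ^ ((k : ℝ) / 2 - 1 / 4)) := by
          rw [← Real.sqrt_eq_rpow]
          exact mul_le_mul_of_nonneg_right (Nat.floor_le (Real.sqrt_nonneg x)) (by positivity)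
      _ = C * x ^ ((k : ℝ) / 2 + 1 / 4) := by
          rw [mul_left_comm, ← Real.rpow_add hx0]
          ring_nf
  calc _ = |∑ i ∈ Finset.range ⌊√x⌋₊, squarefreeIndicator (i + 1) *
        (squarefreeBallCount k (x - ((i + 1 : ℕ) : ℝ) ^ 2)
          - c * max (x - ((i + 1 : ℕ) : ℝ) ^ 2) 0 ^ ((k : ℝ) / 2))
        + c * (∑ i ∈ Finset.range ⌊√x⌋₊, squarefreeIndicator (i + 1) *
          max (x - ((i + 1 : ℕ) : ℝ) ^ 2) 0 ^ ((k : ℝ) / 2)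
          - zetaTwo⁻¹ * (x ^ ((k : ℝ) / 2 + 1 / 2) * I))| := by
        congr 1
        rw [squarefreeBallCount_succ, hconst]
        simp only [mul_sub, Finset.sum_sub_distrib, Finset.mul_sum, mul_left_comm c]
        ring
    _ ≤ _ := (abs_add_le _ _).trans (by linarith)

/-- Slices have radii squared `y = x - m²` that may be close to 0, so the error is measured by the
outer `x ≥ 1`, uniformly in `y`. -/
theorem exists_abs_squarefreeBallCount_sub_le (k : ℕ) :
    ∃ C : ℝ, 0 ≤ C ∧ ∀ x y : ℝ, 1 ≤ x → 0 ≤ y → y ≤ x →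
      |squarefreeBallCount k y - unitBallVolume k / (2 * zetaTwo) ^ k * y ^ ((k : ℝ) / 2)|
        ≤ C * x ^ ((k : ℝ) / 2 - 1 / 4) := by
  induction k with
  | zero =>
    -- In dimension 0 the count and the main term are both 1, so there is no error.
    refine ⟨0, le_rfl, fun x y _ hy _ => ?_⟩
    simp [squarefreeBallCount_zero hy, unitBallVolume]
  | succ k ih =>
    obtain ⟨C, hC, h⟩ := ih
    obtain ⟨C', h'⟩ := exists_abs_squarefreeBallCount_succ_sub_le hC h
    have hc0 : 0 ≤ unitBallVolume (k + 1) / (2 * zetaTwo) ^ (k + 1) :=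
      (div_pos (unitBallVolume_pos _) (pow_pos (by linarith [zetaTwo_pos]) _)).le
    set c := unitBallVolume (k + 1) / (2 * zetaTwo) ^ (k + 1)
    -- For `y < 1` the count vanishes and the main term is at most `c`.
    refine ⟨max C' c, le_max_of_le_right hc0, fun x y hx hy hyx => ?_⟩
    have e1 : ((k + 1 : ℕ) : ℝ) / 2 = (k : ℝ) / 2 + 1 / 2 := by push_cast; ring
    have e2 : (k : ℝ) / 2 + 1 / 2 - 1 / 4 = (k : ℝ) / 2 + 1 / 4 := by ring
    rw [e1, e2]
    rcases le_or_gt 1 y with hy1 | hy1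
    · refine (h' y hy1).trans ?_
      have hpow : y ^ ((k : ℝ) / 2 + 1 / 4) ≤ x ^ ((k : ℝ) / 2 + 1 / 4) :=
        Real.rpow_le_rpow hy hyx (by positivity)
      exact mul_le_mul (le_max_left _ _) hpow (by positivity) (le_max_of_le_right hc0)
    · rw [squarefreeBallCount_succ_eq_zero k hy1, zero_sub, abs_neg, abs_of_nonneg (by positivity)]
      exact mul_le_mul (le_max_right _ _) ((Real.rpow_le_one hy hy1.le (by positivity)).trans
        (Real.one_le_rpow hx (by positivity))) (by positivity) (le_max_of_le_right hc0)

theorem mainTheorem5 (k : ℕ) (hk : 2 ≤ k) (ε : ℝ) (hε : 0 < ε) :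
    ∃ C : ℝ, ∀ x : ℝ, 1 ≤ x →
      |(∑ n ∈ positiveBallPoints k x,
            ((ArithmeticFunction.moebius (Finset.univ.lcm n) : ℤ) : ℝ) ^ 2)
          - unitBallVolume k / (2 * zetaTwo) ^ k * x ^ ((k : ℝ) / 2)|
        ≤ C * x ^ ((k : ℝ) / 2 - 1 / 4 + ε) := by
  obtain ⟨C, hC, h⟩ := exists_abs_squarefreeBallCount_sub_le k
  refine ⟨C, fun x hx => ?_⟩
  have hsum : ∑ n ∈ positiveBallPoints k x,
      ((ArithmeticFunction.moebius (Finset.univ.lcm n) : ℤ) : ℝ) ^ 2 = squarefreeBallCount k x :=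
    Finset.sum_congr rfl fun n _ => squarefreeIndicator_lcm n
  rw [hsum]
  refine (h x x hx (zero_le_one.trans hx) le_rfl).trans (mul_le_mul_of_nonneg_left ?_ hC)
  exact Real.rpow_le_rpow_of_exponent_le hx (by linarith)
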